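/- Let $R\neq 0$ be an ordered vector space over an ordered division ring $D$ (not necessarily commutative), let $R$ carry the order topology and $R^m$ the product topology, and let $n\ge 1$. A function $R^m\to R$ of the form $x\mapsto \lambda_1x_1+\dots+\lambda_mx_m+a$ with $\lambda_i\in D$, $a\in R$ is called linear. For $X\subseteq R^m$ let $L(X)$ be the set of restrictions to $X$ of linear functions, and $L_\infty(X)=L(X)\cup\{-\infty,+\infty\}$, where $\pm\infty$ are regarded as constant functions. For $f\in L(X)$ let $\Gamma(f)=\{(x,f(x)):x\in X\}$, and for $f,g\in L_\infty(X)$ with $f<g$ on $X$ let $(f,g)_X=\{(x,y)\in X\times R: f(x)<y<g(x)\}$. The linear cells in $R$ are the singletons and the nonempty open intervals with endpoints in $R\cup\{\pm\infty\}$; the linear cells in $R^{m+1}$ are the sets $\Gamma(f)$ with $f\in L(X)$ and $(f,g)_X$ with $f,g\in L_\infty(X)$, $f<g$, where $X$ is a linear cell in $R^m$. Let $\pi:R^{m+1}\to R^m$ be the projection onto the first $m$ coordinates. A linear decomposition of $R$ is a finite partition of $R$ into linear cells; a linear decomposition of $R^{m+1}$, $m\geq 1$, is a finite partition $\mathcal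 C$ of $R^{m+1}$ into linear cells such that $\pi(\mathcal C)=\{\pi(C):C\in\mathcal C\}$ is a linear decomposition of $R^m$. Every linear decomposition of $R$ is called special; a linear decomposition $\mathcal C$ of $R^{m+1}$, $m\ge 1$, is called special if $\pi(\mathcal C)$ is a special linear decomposition of $R^m$ and, for any two cells $\Gamma(h_{|A})$ and $(f,g)_B$ in $\mathcal C$, there is no $c\in \mathrm{cl}(A)\cap \mathrm{cl}(B)$ with $f(c)<h(c)<g(c)$. (Here $f$, $g$, $h$ are extended to the closures by the linear, or constant $\pm\infty$, functions on $R^m$ that define them; these extensions are unique.) Then for every linear decomposition $\mathcal D$ of $R^n$ there is a special linear decomposition $\mathcal C$ of $R^n$ that refines $\mathcal D$, that is, every cell in $\mathcal D$ is a union of cells in $\mathcal C$. -/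

import Mathlib

namespace LinearCells

/-- The values `R ∪ {-∞, +∞}`, with `-∞` below and `+∞` above all elements of `R`. -/
abbrev Ext (R : Type*) : Type _ := WithBot (WithTop R)

/-- The inclusion of `R` in `R ∪ {-∞, +∞}`. -/
abbrev toExt {R : Type*} (r : R) : Ext R := ((r : WithTop R) : WithBot (WithTop R))

/-- The projection `R^(n+1) → R^n` onto the first `n` coordinates. -/
def proj {R : Type*} {n : ℕ} (x : Fin (n + 1) → R) : Fin n → R := fun i => x i.castSucc

/-- The last coordinate of a point of `R^(n+1)`. -/
def last {R : Type*} {n : ℕ} (x : Fin (n + 1) → R) : R := x (Fin.last n)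

/-- The linear (affine) functions `f (x₁, …, xₙ) = λ₁ x₁ + ⋯ + λₙ xₙ + a` on `R^n`, with
`λᵢ ∈ D` and `a ∈ R`. -/
def IsLinearFun (D : Type*) {R : Type*} [DivisionRing D] [AddCommGroup R] [Module D R] {n : ℕ}
    (f : (Fin n → R) → R) : Prop :=
  ∃ (l : Fin n → D) (a : R), ∀ x, f x = ∑ i, l i • x i + a

/-- The functions on `R^n` that are linear, or constant `-∞`, or constant `+∞`. -/
def IsLinearFunInfty (D : Type*) {R : Type*} [DivisionRing D] [AddCommGroup R] [Module D R]
    {n : ℕ} (f : (Fin n → R) → Ext R) : Prop :=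
  (∃ f₀ : (Fin n → R) → R, IsLinearFun D f₀ ∧ ∀ x, f x = toExt (f₀ x)) ∨
    (∀ x, f x = ⊥) ∨ (∀ x, f x = ⊤)

/-- The graph `Γ(f|X)` of the restriction of `f` to `X`, as a subset of `R^(n+1)`. -/
def graphOn {R : Type*} {n : ℕ} (X : Set (Fin n → R)) (f : (Fin n → R) → R) :
    Set (Fin (n + 1) → R) :=
  {x | proj x ∈ X ∧ last x = f (proj x)}

/-- The band `(f, g)_X = {(x, y) : x ∈ X, f x < y < g x}`, as a subset of `R^(n+1)`. -/
def band {R : Type*} [LinearOrder R] {n : ℕ} (X : Set (Fin n → R)) (f g : (Fin n → R) → Ext R) :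
    Set (Fin (n + 1) → R) :=
  {x | proj x ∈ X ∧ f (proj x) < toExt (last x) ∧ toExt (last x) < g (proj x)}

/-- Linear cells in `R^n`. The recursion starts from the one-point space `R^0`, whose only cell is
the whole space; as linear functions on `R^0` are the constants of `R`, the linear cells in `R^1`
are then the singletons and the nonempty open intervals with endpoints in `R ∪ {-∞, +∞}`. -/
def IsLinearCell (D : Type*) {R : Type*} [DivisionRing D] [AddCommGroup R] [LinearOrder R]
    [Module D R] : (n : ℕ) → Set (Fin n → R) → Prop
  | 0, C => C = Set.univ
  | n + 1, C => ∃ X : Set (Fin n → R), IsLinearCell D n X ∧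
      ((∃ f : (Fin n → R) → R, IsLinearFun D f ∧ C = graphOn X f) ∨
        ∃ f g : (Fin n → R) → Ext R, IsLinearFunInfty D f ∧ IsLinearFunInfty D g ∧
          (∀ x ∈ X, f x < g x) ∧ C = band X f g)

/-- The family `π(𝒞) = {π(C) : C ∈ 𝒞}` of projections of the members of a family `𝒞`. -/
def projFamily {R : Type*} {n : ℕ} (𝒞 : Set (Set (Fin (n + 1) → R))) : Set (Set (Fin n → R)) :=
  {B | ∃ C ∈ 𝒞, B = proj '' C}

/-- Linear decompositions of `R^n`: finite partitions into linear cells whose projections form a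
linear decomposition of `R^(n-1)`. The recursion starts from the decomposition `{R^0}` of `R^0`.
For `n = 1` the condition on projections is automatic, and a finite partition of `R` into points and
open intervals is exactly a family `(-∞, a₁), {a₁}, (a₁, a₂), …, {a_k}, (a_k, +∞)` with
`a₁ < ⋯ < a_k`. -/
def IsLinearDecomposition (D : Type*) {R : Type*} [DivisionRing D] [AddCommGroup R]
    [LinearOrder R] [Module D R] : (n : ℕ) → Set (Set (Fin n → R)) → Prop
  | 0, 𝒞 => 𝒞 = {Set.univ}
  | n + 1, 𝒞 => 𝒞.Finite ∧ Setoid.IsPartition 𝒞 ∧ (∀ C ∈ 𝒞, IsLinearCell D (n + 1) C) ∧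
      IsLinearDecomposition D n (projFamily 𝒞)

/-- Special linear decompositions of `R^n`. For `n ≥ 2`, no graph cell `Γ(h|A)` passes strictly
between the bounding functions of a band cell `(f, g)_B` at a point of `cl(A) ∩ cl(B)`.
The values at points of the closures are those of the linear functions on the whole space; they
depend only on the restrictions of these functions to `A` and `B`. -/
def IsSpecialLinearDecomposition (D : Type*) {R : Type*} [DivisionRing D] [AddCommGroup R]
    [LinearOrder R] [Module D R] [TopologicalSpace R] : (n : ℕ) → Set (Set (Fin n → R)) → Prop
  | 0, 𝒞 => IsLinearDecomposition D 0 𝒞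
  | 1, 𝒞 => IsLinearDecomposition D 1 𝒞
  | k + 2, 𝒞 => IsLinearDecomposition D (k + 2) 𝒞 ∧
      IsSpecialLinearDecomposition D (k + 1) (projFamily 𝒞) ∧
      ∀ (A B : Set (Fin (k + 1) → R)) (h : (Fin (k + 1) → R) → R)
        (f g : (Fin (k + 1) → R) → Ext R),
        IsLinearFun D h → IsLinearFunInfty D f → IsLinearFunInfty D g →
        (∀ x ∈ B, f x < g x) → graphOn A h ∈ 𝒞 → band B f g ∈ 𝒞 →
        ¬ ∃ c ∈ closure A ∩ closure B, f c < toExt (h c) ∧ toExt (h c) < g c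

/-- `𝒞` refines `𝒟`: every member of `𝒟` is a union of members of `𝒞`. -/
def Refines {α : Type*} (𝒞 𝒟 : Set (Set α)) : Prop :=
  ∀ E ∈ 𝒟, ∃ 𝒮 ⊆ 𝒞, E = ⋃₀ 𝒮

end LinearCells

open Set Topology

namespace LinearCells

/-! Membership in each cell of `𝒟` depends only on the signs of finitely many linear functions
(`IsLinearCell.exists_finite_sign`), so it suffices to find a special decomposition on whose cells
these signs are constant (`exists_special_sign_const`). This goes by induction on the dimension.
Each function either ignores the last coordinate or, up to a scalar, compares it with a linear
function `h` of the others. Let `H` be the set of these `h`. Apply induction to the functions on the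
base and to all differences of members of `H`; over each base cell the members of `H` are then
consistently ordered, and their graphs cut the cylinder into cells. The result is special because
the same `H` is used over every base cell: each `h` in `H` lies weakly below or weakly above a given
band throughout, and weak inequalities survive closure. Decompositions are handled as fibres of a
labelling `φ` into a finite type, which makes the partition property automatic. -/

@[simp] theorem proj_snoc {R : Type*} {n : ℕ} (y : Fin n → R) (t : R) :
    proj (Fin.snoc y t : Fin (n + 1) → R) = y := by
  funext i; simp [proj]

@[simp] theorem last_snoc {R : Type*} {n : ℕ} (y : Fin n → R) (t : R) :
    last (Fin.snoc y t : Fin (n + 1) → R) = t := by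
  simp [last]

theorem proj_image_graphOn {R : Type*} {n : ℕ} (X : Set (Fin n → R)) (f : (Fin n → R) → R) :
    proj '' graphOn X f = X := by
  ext y
  constructor
  · rintro ⟨z, hz, rfl⟩
    exact hz.1
  · exact fun hy => ⟨Fin.snoc y (f y), by simpa [graphOn] using hy, by simp⟩

/-! ### Algebra of linear functions. -/

section Basic

variable {D : Type*} [DivisionRing D] {R : Type*} [AddCommGroup R] [Module D R] {n : ℕ}

theorem isLinearFun_zero : IsLinearFun D (fun _ : Fin n → R => (0 : R)) :=
  ⟨0, 0, fun x => by simp⟩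

theorem IsLinearFun.sub {f g : (Fin n → R) → R} (hf : IsLinearFun D f) (hg : IsLinearFun D g) :
    IsLinearFun D (f - g) := by
  obtain ⟨l, a, hf⟩ := hf
  obtain ⟨m, b, hg⟩ := hg
  refine ⟨l - m, a - b, fun x => ?_⟩
  simp only [Pi.sub_apply, hf, hg, sub_smul, Finset.sum_sub_distrib]
  abel

theorem IsLinearFun.comp_proj {f : (Fin n → R) → R} (hf : IsLinearFun D f) :
    IsLinearFun D (fun x : Fin (n + 1) → R => f (proj x)) := by
  obtain ⟨l, a, hf⟩ := hf
  exact ⟨Fin.snoc l 0, a, fun x => by simp [hf, Fin.sum_univ_castSucc, proj]⟩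

theorem isLinearFun_last : IsLinearFun D (fun x : Fin (n + 1) → R => last x) :=
  ⟨Fin.snoc 0 1, 0, fun x => by simp [Fin.sum_univ_castSucc, last]⟩

theorem IsLinearFun.last_sub {f : (Fin n → R) → R} (hf : IsLinearFun D f) :
    IsLinearFun D (fun x : Fin (n + 1) → R => last x - f (proj x)) :=
  isLinearFun_last.sub hf.comp_proj

/-- Solving `f = 0` for the last coordinate; as `D` need not commute, the inverse of the leading
coefficient multiplies on the left. -/
theorem IsLinearFun.eq_comp_proj_or_eq_smul {f : (Fin (n + 1) → R) → R} (hf : IsLinearFun D f) :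
    (∃ f', IsLinearFun D f' ∧ ∀ x, f x = f' (proj x)) ∨
      ∃ (c : D) (h : (Fin n → R) → R), IsLinearFun D h ∧ ∀ x, f x = c • (last x - h (proj x)) := by
  obtain ⟨l, a, hf⟩ := hf
  by_cases hl : l (Fin.last n) = 0
  · exact Or.inl ⟨fun y => ∑ i, l i.castSucc • y i + a, ⟨_, _, fun _ => rfl⟩, fun x => by
      simp [hf, Fin.sum_univ_castSucc, hl, proj]⟩
  · refine Or.inr ⟨l (Fin.last n), fun y => ∑ i, (-((l (Fin.last n))⁻¹ * l i.castSucc)) • y i +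
      -((l (Fin.last n))⁻¹ • a), ⟨_, _, fun _ => rfl⟩, fun x => ?_⟩
    simp only [hf, Fin.sum_univ_castSucc, last, proj, smul_sub, smul_add, Finset.smul_sum, smul_neg,
      smul_smul, neg_smul, mul_inv_cancel_left₀ hl, mul_inv_cancel₀ hl, one_smul,
      Finset.sum_neg_distrib]
    abel

end Basic

/-! ### Signs, density and continuity. -/

section Order

variable {D : Type*} [DivisionRing D] [LinearOrder D] [IsStrictOrderedRing D]
  {R : Type*} [AddCommGroup R] [LinearOrder R] [IsOrderedAddMonoid R]
  [Module D R] [IsStrictOrderedModule D R]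

theorem sign_smul_eq_mul (c : D) (t : R) :
    SignType.sign (c • t) = SignType.sign c * SignType.sign t := by
  rcases lt_trichotomy c 0 with hc | rfl | hc <;> rcases lt_trichotomy t 0 with ht | rfl | ht
  · simp [sign_neg hc, sign_neg ht, sign_pos (smul_pos_of_neg_of_neg hc ht)]
  · simp
  · simp [sign_neg hc, sign_pos ht, sign_neg (smul_neg_of_neg_of_pos hc ht)]
  · simp
  · simp
  · simp
  · simp [sign_pos hc, sign_neg ht, sign_neg (smul_neg_of_pos_of_neg hc ht)]
  · simp
  · simp [sign_pos hc, sign_pos ht, sign_pos (smul_pos hc ht)]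

/-- The sign of a linear function on `R^(n+1)` is determined by the sign of a linear function of the
first `n` coordinates and the position of the last coordinate relative to another one. -/
theorem IsLinearFun.exists_sign_eq {n : ℕ} {f : (Fin (n + 1) → R) → R} (hf : IsLinearFun D f) :
    ∃ f' h : (Fin n → R) → R, IsLinearFun D f' ∧ IsLinearFun D h ∧ ∀ x y,
      SignType.sign (f' (proj x)) = SignType.sign (f' (proj y)) →
      SignType.sign (last x - h (proj x)) = SignType.sign (last y - h (proj y)) →
      SignType.sign (f x) = SignType.sign (f y) := by
  rcases hf.eq_comp_proj_or_eq_smul with ⟨f', hf', e⟩ | ⟨c, h, hh, e⟩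
  -- The zero function fills whichever slot carries no information.
  · exact ⟨f', _, hf', isLinearFun_zero, fun x y h₁ _ => by rw [e, e, h₁]⟩
  · exact ⟨_, h, isLinearFun_zero, hh, fun x y _ h₂ => by
      rw [e, e, sign_smul_eq_mul, sign_smul_eq_mul, h₂]⟩

theorem denselyOrdered_of_module (D R : Type*) [DivisionRing D] [LinearOrder D]
    [IsStrictOrderedRing D] [AddCommGroup R] [LinearOrder R] [IsOrderedAddMonoid R]
    [Module D R] [IsStrictOrderedModule D R] :
    DenselyOrdered R := by
  refine ⟨fun a b hab => ⟨a + (2⁻¹ : D) • (b - a), ?_, ?_⟩⟩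
  · exact lt_add_of_pos_right _ (smul_pos (by positivity) (sub_pos.2 hab))
  · have h : a + (2⁻¹ : D) • (b - a) + (2⁻¹ : D) • (b - a) = b := by
      rw [add_assoc, ← add_smul, ← two_mul, mul_inv_cancel₀ two_ne_zero, one_smul]
      abel
    calc _ < a + (2⁻¹ : D) • (b - a) + (2⁻¹ : D) • (b - a) :=
          lt_add_of_pos_right _ (smul_pos (by positivity) (sub_pos.2 hab))
      _ = b := h

/-- A positive scalar acts as a monotone surjection of a dense order, hence continuously; a negative
one differs by negation. -/
theorem continuousConstSMul_of_orderTopology (D R : Type*) [DivisionRing D] [LinearOrder D]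
    [IsStrictOrderedRing D] [AddCommGroup R] [LinearOrder R] [IsOrderedAddMonoid R]
    [Module D R] [IsStrictOrderedModule D R]
    [TopologicalSpace R] [OrderTopology R] :
    ContinuousConstSMul D R := by
  have := denselyOrdered_of_module D R
  have pos : ∀ c : D, 0 < c → Continuous fun x : R => c • x := fun c hc =>
    Monotone.continuous_of_surjective (fun _ _ h => smul_le_smul_of_nonneg_left h hc.le)
      fun x => ⟨c⁻¹ • x, by simp [smul_smul, mul_inv_cancel₀ hc.ne']⟩
  refine ⟨fun c => ?_⟩
  rcases lt_trichotomy c 0 with hc | rfl | hc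
  · have h : (fun x : R => c • x) = fun x => -(-c • x) := by simp
    exact h ▸ (pos (-c) (neg_pos.2 hc)).neg
  · simpa using continuous_const
  · exact pos c hc

theorem IsLinearFun.continuous [TopologicalSpace R] [OrderTopology R] {n : ℕ}
    {f : (Fin n → R) → R} (hf : IsLinearFun D f) : Continuous f := by
  have := continuousConstSMul_of_orderTopology D R
  obtain ⟨l, a, hf⟩ := hf
  rw [funext hf]
  fun_prop

end Order

/-! ### Weak inequalities pass to closures. -/

section Closure

variable {D : Type*} [DivisionRing D] [LinearOrder D] [IsStrictOrderedRing D]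
  {R : Type*} [AddCommGroup R] [LinearOrder R] [IsOrderedAddMonoid R]
  [Module D R] [IsStrictOrderedModule D R] [TopologicalSpace R] [OrderTopology R] {n : ℕ}
  {h : (Fin n → R) → R} {f : (Fin n → R) → Ext R}

theorem IsLinearFunInfty.isClosed_le (hf : IsLinearFunInfty D f) (hh : IsLinearFun D h) :
    IsClosed {y | toExt (h y) ≤ f y} := by
  rcases hf with ⟨f₀, hf₀, e⟩ | e | e
  · simpa [e, toExt] using _root_.isClosed_le hh.continuous hf₀.continuous
  · simp [e, toExt]
  · simp [e]

theorem IsLinearFunInfty.isClosed_ge (hf : IsLinearFunInfty D f) (hh : IsLinearFun D h) :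
    IsClosed {y | f y ≤ toExt (h y)} := by
  rcases hf with ⟨f₀, hf₀, e⟩ | e | e
  · simpa [e, toExt] using _root_.isClosed_le hf₀.continuous hh.continuous
  · simp [e]
  · have : ∀ y, ¬ (⊤ : Ext R) ≤ toExt (h y) := fun y => by
      rw [not_le]
      exact WithBot.coe_lt_coe.2 (WithTop.coe_lt_top _)
    simp [e, this]

end Closure

section Band

variable {R : Type*} [LinearOrder R] [DenselyOrdered R] [NoMaxOrder R] [NoMinOrder R] [Nonempty R]

theorem exists_toExt_between {a b : Ext R} (hab : a < b) : ∃ t : R, a < toExt t ∧ toExt t < b := by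
  obtain ⟨e, h₁, h₂⟩ := exists_between hab
  induction e using WithBot.recBotCoe with
  | bot => exact absurd h₁ not_lt_bot
  | coe e =>
    induction e using WithTop.recTopCoe with
    | top => exact absurd h₂ (not_lt.2 le_top)
    | coe t => exact ⟨t, h₁, h₂⟩

variable {n : ℕ} {X : Set (Fin n → R)} {f g : (Fin n → R) → Ext R}

theorem proj_image_band (hfg : ∀ x ∈ X, f x < g x) : proj '' band X f g = X := by
  ext y
  constructor
  · rintro ⟨z, hz, rfl⟩
    exact hz.1
  · intro hy
    obtain ⟨t, h₁, h₂⟩ := exists_toExt_between (hfg y hy)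
    refine ⟨Fin.snoc y t, ?_, proj_snoc y t⟩
    simpa only [band, mem_ofPred_eq, proj_snoc, last_snoc] using ⟨hy, h₁, h₂⟩

end Band

/-! ### Cutting cylinders along the graphs of `H`. -/

section Lift

variable {D : Type*} [DivisionRing D] {R : Type*} [AddCommGroup R] [LinearOrder R] {n : ℕ}
  {ι : Type*} (φ : (Fin n → R) → ι) (H : Set ((Fin n → R) → R))

/-- The cell label `φ` of the projection of a point of `R^(n+1)`, together with the position of its
last coordinate relative to the functions in `H`. -/
def liftLabel (x : Fin (n + 1) → R) : ι × (H → SignType) :=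
  (φ (proj x), fun h => SignType.sign (last x - h.1 (proj x)))

variable {φ H}

theorem liftLabel_eq_iff {x y : Fin (n + 1) → R} : liftLabel φ H x = liftLabel φ H y ↔
    φ (proj x) = φ (proj y) ∧
      ∀ h ∈ H, SignType.sign (last x - h (proj x)) = SignType.sign (last y - h (proj y)) := by
  simp [liftLabel, Prod.ext_iff, funext_iff]

variable [IsOrderedAddMonoid R]

theorem compare_congr_of_sign_sub_eq {a b c d : R} (h : SignType.sign (a - b) = SignType.sign (c - d)) :
    (a < b ↔ c < d) ∧ (b < a ↔ d < c) ∧ (a = b ↔ c = d) := by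
  refine ⟨?_, ?_, ?_⟩
  · rw [← sub_neg, ← sign_eq_neg_one_iff, h, sign_eq_neg_one_iff, sub_neg]
  · rw [← sub_pos, ← sign_eq_one_iff, h, sign_eq_one_iff, sub_pos]
  · rw [← sub_eq_zero, ← sign_eq_zero_iff, h, sign_eq_zero_iff, sub_eq_zero]

variable [Module D R]

/-- Among the members of `H` below `t` at `p`, the greatest at `p` stays greatest on the whole fibre
of `φ`, since differences keep their sign there. -/
theorem exists_lower (hH : H.Finite) (hlin : ∀ h ∈ H, IsLinearFun D h)
    (hφ : ∀ h ∈ H, ∀ h' ∈ H, ∀ x y, φ x = φ y →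
      SignType.sign (h x - h' x) = SignType.sign (h y - h' y)) (p : Fin n → R) (t : R) :
    ∃ f : (Fin n → R) → Ext R, IsLinearFunInfty D f ∧
      ((∀ y, f y = ⊥) ∨ ∃ h₀ ∈ H, h₀ p < t ∧ ∀ y, f y = toExt (h₀ y)) ∧
      ∀ h ∈ H, h p < t → ∀ y, φ y = φ p → toExt (h y) ≤ f y := by
  rcases ({h ∈ H | h p < t}).eq_empty_or_nonempty with he | hne
  · refine ⟨fun _ => ⊥, Or.inr (Or.inl fun _ => rfl), Or.inl fun _ => rfl, fun h hh hlt => ?_⟩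
    have : h ∈ {h ∈ H | h p < t} := ⟨hh, hlt⟩
    simp [he] at this
  · obtain ⟨h₀, ⟨hh₀, hlt₀⟩, hmax⟩ :=
      Set.exists_max_image _ (fun h => h p) (hH.subset (sep_subset H fun h => h p < t)) hne
    refine ⟨fun y => toExt (h₀ y), Or.inl ⟨h₀, hlin _ hh₀, fun _ => rfl⟩,
      Or.inr ⟨h₀, hh₀, hlt₀, fun _ => rfl⟩, fun h hh hlt y hy => ?_⟩
    have h₁ := (compare_congr_of_sign_sub_eq (hφ h₀ hh₀ h hh y p hy)).1
    have h₂ : h y ≤ h₀ y := not_lt.1 fun hc => not_lt.2 (hmax h ⟨hh, hlt⟩) (h₁.1 hc)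
    simpa [toExt] using h₂

theorem exists_upper (hH : H.Finite) (hlin : ∀ h ∈ H, IsLinearFun D h)
    (hφ : ∀ h ∈ H, ∀ h' ∈ H, ∀ x y, φ x = φ y →
      SignType.sign (h x - h' x) = SignType.sign (h y - h' y)) (p : Fin n → R) (t : R) :
    ∃ g : (Fin n → R) → Ext R, IsLinearFunInfty D g ∧
      ((∀ y, g y = ⊤) ∨ ∃ h₀ ∈ H, t < h₀ p ∧ ∀ y, g y = toExt (h₀ y)) ∧
      ∀ h ∈ H, t < h p → ∀ y, φ y = φ p → g y ≤ toExt (h y) := by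
  rcases ({h ∈ H | t < h p}).eq_empty_or_nonempty with he | hne
  · refine ⟨fun _ => ⊤, Or.inr (Or.inr fun _ => rfl), Or.inl fun _ => rfl, fun h hh hlt => ?_⟩
    have : h ∈ {h ∈ H | t < h p} := ⟨hh, hlt⟩
    simp [he] at this
  · obtain ⟨h₀, ⟨hh₀, hlt₀⟩, hmin⟩ :=
      Set.exists_min_image _ (fun h => h p) (hH.subset (sep_subset H fun h => t < h p)) hne
    refine ⟨fun y => toExt (h₀ y), Or.inl ⟨h₀, hlin _ hh₀, fun _ => rfl⟩,
      Or.inr ⟨h₀, hh₀, hlt₀, fun _ => rfl⟩, fun h hh hlt y hy => ?_⟩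
    have h₁ := (compare_congr_of_sign_sub_eq (hφ h₀ hh₀ h hh y p hy)).2.1
    have h₂ : h₀ y ≤ h y := not_lt.1 fun hc => not_lt.2 (hmin h ⟨hh, hlt⟩) (h₁.1 hc)
    simpa [toExt] using h₂

/-- The fibres of `liftLabel φ H` are graphs of functions in `H` or bands over the fibres of `φ`. -/
theorem fiber_liftLabel_eq (hH : H.Finite) (hlin : ∀ h ∈ H, IsLinearFun D h)
    (hφ : ∀ h ∈ H, ∀ h' ∈ H, ∀ x y, φ x = φ y →
      SignType.sign (h x - h' x) = SignType.sign (h y - h' y)) (x : Fin (n + 1) → R) :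
    (∃ h ∈ H, {z | liftLabel φ H z = liftLabel φ H x} = graphOn {y | φ y = φ (proj x)} h) ∨
      ∃ f g, IsLinearFunInfty D f ∧ IsLinearFunInfty D g ∧
        (∀ y ∈ {y | φ y = φ (proj x)}, f y < g y) ∧
        {z | liftLabel φ H z = liftLabel φ H x} = band {y | φ y = φ (proj x)} f g := by
  by_cases hx : ∃ h ∈ H, last x = h (proj x)
  · obtain ⟨h, hh, hxh⟩ := hx
    refine Or.inl ⟨h, hh, ?_⟩
    ext z
    simp only [mem_ofPred_eq, liftLabel_eq_iff, graphOn]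
    refine and_congr_right fun hz => ⟨fun hs => (compare_congr_of_sign_sub_eq (hs h hh)).2.2.2 hxh, ?_⟩
    intro hzh h' hh'
    rw [hzh, hxh]
    exact hφ h hh h' hh' _ _ hz
  · push Not at hx
    obtain ⟨f, hf, hf₁, hf₂⟩ := exists_lower hH hlin hφ (proj x) (last x)
    obtain ⟨g, hg, hg₁, hg₂⟩ := exists_upper hH hlin hφ (proj x) (last x)
    refine Or.inr ⟨f, g, hf, hg, fun y hy => ?_, ?_⟩
    · rcases hf₁ with hf₁ | ⟨h₁, hh₁, hlt₁, hf₁⟩ <;> rcases hg₁ with hg₁ | ⟨h₂, hh₂, hlt₂, hg₁⟩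
      · simp [hf₁, hg₁]
      · simp [hf₁, hg₁, toExt]
      · rw [hf₁, hg₁]
        exact WithBot.coe_lt_coe.2 (WithTop.coe_lt_top _)
      · simpa [hf₁, hg₁, toExt] using
          (compare_congr_of_sign_sub_eq (hφ h₁ hh₁ h₂ hh₂ y _ hy)).1.2 (hlt₁.trans hlt₂)
    · ext z
      simp only [mem_ofPred_eq, liftLabel_eq_iff, band]
      refine and_congr_right fun hz => ⟨fun hs => ⟨?_, ?_⟩, ?_⟩
      · rcases hf₁ with hf₁ | ⟨h₁, hh₁, hlt₁, hf₁⟩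
        · simp [hf₁, toExt]
        · simpa [hf₁, toExt] using (compare_congr_of_sign_sub_eq (hs h₁ hh₁)).2.1.2 hlt₁
      · rcases hg₁ with hg₁ | ⟨h₁, hh₁, hlt₁, hg₁⟩
        · rw [hg₁]
          exact WithBot.coe_lt_coe.2 (WithTop.coe_lt_top _)
        · simpa [hg₁, toExt] using (compare_congr_of_sign_sub_eq (hs h₁ hh₁)).1.2 hlt₁
      -- No member of `H` meets the sample point `x`, so each lies weakly beyond one of the two
      -- bounds over the fibre.
      · rintro ⟨hz₁, hz₂⟩ h hh
        rcases lt_or_gt_of_ne (hx h hh) with hlt | hlt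
        · have : last z < h (proj z) := by
            simpa [toExt] using hz₂.trans_le (hg₂ h hh hlt _ hz)
          rw [sign_neg (sub_neg.2 hlt), sign_neg (sub_neg.2 this)]
        · have : h (proj z) < last z := by
            simpa [toExt] using (hf₂ h hh hlt _ hz).trans_lt hz₁
          rw [sign_pos (sub_pos.2 hlt), sign_pos (sub_pos.2 this)]

end Lift

section Cell

variable {D : Type*} [DivisionRing D] {R : Type*} [AddCommGroup R] [LinearOrder R] [Module D R]

theorem IsLinearDecomposition.isLinearCell :
    ∀ {n : ℕ} {𝒞 : Set (Set (Fin n → R))}, IsLinearDecomposition D n 𝒞 →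
      ∀ C ∈ 𝒞, IsLinearCell D n C
  | 0, _, h, C, hC => by rw [h] at hC; exact hC
  | _ + 1, _, h, C, hC => h.2.2.1 C hC

theorem IsSpecialLinearDecomposition.isLinearDecomposition [TopologicalSpace R] :
    ∀ {n : ℕ} {𝒞 : Set (Set (Fin n → R))}, IsSpecialLinearDecomposition D n 𝒞 →
      IsLinearDecomposition D n 𝒞
  | 0, _, h => h
  | 1, _, h => h
  | _ + 2, _, h => h.1

end Cell

/-! ### The lifted decomposition is special. -/

section Special

variable {D : Type*} [DivisionRing D] [LinearOrder D] [IsStrictOrderedRing D]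
  {R : Type*} [AddCommGroup R] [LinearOrder R] [IsOrderedAddMonoid R] [Nontrivial R]
  [Module D R] [IsStrictOrderedModule D R] {n : ℕ}
  {ι : Type*} {φ : (Fin n → R) → ι} {H : Set ((Fin n → R) → R)}

theorem projFamily_classes_liftLabel (hH : H.Finite) (hlin : ∀ h ∈ H, IsLinearFun D h)
    (hφ : ∀ h ∈ H, ∀ h' ∈ H, ∀ x y, φ x = φ y →
      SignType.sign (h x - h' x) = SignType.sign (h y - h' y)) :
    projFamily (Setoid.ker (liftLabel φ H)).classes = (Setoid.ker φ).classes := by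
  have := denselyOrdered_of_module D R
  have key : ∀ x, proj '' {z | liftLabel φ H z = liftLabel φ H x} = {y | φ y = φ (proj x)} := by
    intro x
    rcases fiber_liftLabel_eq hH hlin hφ x with ⟨h, -, e⟩ | ⟨f, g, -, -, hfg, e⟩
    · rw [e, proj_image_graphOn]
    · rw [e, proj_image_band hfg]
  ext B
  constructor
  · rintro ⟨C, ⟨x, rfl⟩, rfl⟩
    exact ⟨proj x, key x⟩
  · rintro ⟨y, rfl⟩
    refine ⟨_, ⟨Fin.snoc y 0, rfl⟩, ?_⟩
    have := key (Fin.snoc y 0)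
    rw [proj_snoc] at this
    exact this.symm

theorem isLinearDecomposition_classes_liftLabel [Finite ι] (hH : H.Finite)
    (hlin : ∀ h ∈ H, IsLinearFun D h)
    (hφ : ∀ h ∈ H, ∀ h' ∈ H, ∀ x y, φ x = φ y →
      SignType.sign (h x - h' x) = SignType.sign (h y - h' y))
    (hcell : ∀ y, IsLinearCell D n {y' | φ y' = φ y})
    (hdec : IsLinearDecomposition D n (Setoid.ker φ).classes) :
    IsLinearDecomposition D (n + 1) (Setoid.ker (liftLabel φ H)).classes := by
  have := hH.to_subtype
  refine ⟨Setoid.finite_classes_ker _, Setoid.isPartition_classes _, ?_, ?_⟩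
  · rintro C ⟨x, rfl⟩
    refine ⟨_, hcell (proj x), ?_⟩
    rcases fiber_liftLabel_eq hH hlin hφ x with ⟨h, hh, e⟩ | ⟨f, g, hf, hg, hfg, e⟩
    · exact Or.inl ⟨h, hlin h hh, e⟩
    · exact Or.inr ⟨f, g, hf, hg, hfg, e⟩
  · rwa [projFamily_classes_liftLabel hH hlin hφ]

/-- A function in `H` does not pass strictly between the bounds of a band cell. -/
theorem forall_le_or_forall_ge_of_band {h : (Fin n → R) → R} (hh : h ∈ H)
    {B : Set (Fin n → R)} {f g : (Fin n → R) → Ext R} (hfg : ∀ y ∈ B, f y < g y)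
    [DenselyOrdered R] (hB : band B f g ∈ (Setoid.ker (liftLabel φ H)).classes) :
    (∀ y ∈ B, toExt (h y) ≤ f y) ∨ ∀ y ∈ B, g y ≤ toExt (h y) := by
  obtain ⟨x, hx⟩ := hB
  have sgn : ∀ y ∈ B, ∀ t, f y < toExt t → toExt t < g y →
      SignType.sign (t - h y) = SignType.sign (last x - h (proj x)) := by
    intro y hy t h₁ h₂
    have hm : (Fin.snoc y t : Fin (n + 1) → R) ∈ band B f g := by simpa [band] using ⟨hy, h₁, h₂⟩
    rw [hx] at hm
    simpa using (liftLabel_eq_iff.1 hm).2 h hh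
  rcases le_or_gt (last x) (h (proj x)) with hle | hlt
  · refine Or.inr fun y hy => not_lt.1 fun hc => ?_
    -- A height inside the band but above `h` contradicts the sign at `x`.
    obtain ⟨t, h₁, h₂⟩ := exists_toExt_between (max_lt (hfg y hy) hc)
    have h₃ : h y < t := by simpa [toExt] using (le_max_right _ _).trans_lt h₁
    exact not_lt.2 hle
      ((compare_congr_of_sign_sub_eq (sgn y hy t ((le_max_left _ _).trans_lt h₁) h₂)).2.1.1 h₃)
  · refine Or.inl fun y hy => not_lt.1 fun hc => ?_
    obtain ⟨t, h₁, h₂⟩ := exists_toExt_between (lt_min (hfg y hy) hc)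
    have h₃ : t < h y := by simpa [toExt] using h₂.trans_le (min_le_right _ _)
    exact not_lt.2 hlt.le
      ((compare_congr_of_sign_sub_eq (sgn y hy t h₁ (h₂.trans_le (min_le_left _ _)))).1.1 h₃)

/-- Specialness quantifies over every linear `h` representing a graph cell, so `h` must be traded
for a member of `H`. The cell cannot be a band, whose vertical fibres have more than one point. -/
theorem exists_eqOn_of_graphOn (hH : H.Finite) (hlin : ∀ h ∈ H, IsLinearFun D h)
    (hφ : ∀ h ∈ H, ∀ h' ∈ H, ∀ x y, φ x = φ y →
      SignType.sign (h x - h' x) = SignType.sign (h y - h' y))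
    {A : Set (Fin n → R)} {h : (Fin n → R) → R}
    (hA : graphOn A h ∈ (Setoid.ker (liftLabel φ H)).classes) : ∃ h' ∈ H, EqOn h h' A := by
  have := denselyOrdered_of_module D R
  obtain ⟨x, hx⟩ := hA
  change graphOn A h = {z | liftLabel φ H z = liftLabel φ H x} at hx
  rcases fiber_liftLabel_eq hH hlin hφ x with ⟨h', hh', e⟩ | ⟨f, g, -, -, -, e⟩
  · refine ⟨h', hh', fun y hy => ?_⟩
    have hm : (Fin.snoc y (h y) : Fin (n + 1) → R) ∈ graphOn A h := by simpa [graphOn] using hy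
    rw [hx, e] at hm
    simpa using hm.2
  · have hxm : x ∈ {z | liftLabel φ H z = liftLabel φ H x} := rfl
    have hxb := hxm
    rw [← hx] at hxm
    rw [e] at hxb
    obtain ⟨t, h₁, h₂⟩ := exists_toExt_between hxb.2.2
    have hm : (Fin.snoc (proj x) t : Fin (n + 1) → R) ∈ band {y | φ y = φ (proj x)} f g := by
      simpa [band] using ⟨hxb.2.1.trans h₁, h₂⟩
    rw [← e, ← hx] at hm
    have h₃ : t = h (proj x) := by simpa using hm.2
    have h₄ : last x < t := by simpa [toExt] using h₁
    exact absurd (hxm.2.trans h₃.symm) h₄.ne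

theorem isSpecialLinearDecomposition_classes_liftLabel [TopologicalSpace R] [OrderTopology R]
    [Finite ι] (hH : H.Finite) (hlin : ∀ h ∈ H, IsLinearFun D h)
    (hφ : ∀ h ∈ H, ∀ h' ∈ H, ∀ x y, φ x = φ y →
      SignType.sign (h x - h' x) = SignType.sign (h y - h' y))
    (hs : IsSpecialLinearDecomposition D n (Setoid.ker φ).classes) :
    IsSpecialLinearDecomposition D (n + 1) (Setoid.ker (liftLabel φ H)).classes := by
  have hd := isLinearDecomposition_classes_liftLabel hH hlin hφ
    (fun y => hs.isLinearDecomposition.isLinearCell _ ⟨y, rfl⟩) hs.isLinearDecomposition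
  cases n with
  | zero => exact hd
  | succ k =>
    refine ⟨hd, by rwa [projFamily_classes_liftLabel hH hlin hφ], ?_⟩
    rintro A B h f g hh hf hg hfg hA hB ⟨c, ⟨hcA, hcB⟩, hc₁, hc₂⟩
    have := denselyOrdered_of_module D R
    obtain ⟨h', hh', heq⟩ := exists_eqOn_of_graphOn hH hlin hφ hA
    -- Continuity extends the agreement on `A` to the point `c` of its closure.
    rw [heq.closure hh.continuous (hlin h' hh').continuous hcA] at hc₁ hc₂
    rcases forall_le_or_forall_ge_of_band hh' hfg hB with hle | hge
    · exact not_le.2 hc₁ (closure_minimal hle (hf.isClosed_le (hlin h' hh')) hcB)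
    · exact not_le.2 hc₂ (closure_minimal hge (hg.isClosed_ge (hlin h' hh')) hcB)

end Special

universe u

/-- For finitely many linear functions on `R^n` there is a special linear decomposition such that
each of the functions has constant sign on each cell. -/
theorem exists_special_sign_const {D : Type*} [DivisionRing D] [LinearOrder D]
    [IsStrictOrderedRing D] {R : Type u} [AddCommGroup R] [LinearOrder R] [IsOrderedAddMonoid R]
    [Nontrivial R] [Module D R] [IsStrictOrderedModule D R] [TopologicalSpace R] [OrderTopology R]
    (n : ℕ) : ∀ F : Set ((Fin n → R) → R), F.Finite → (∀ f ∈ F, IsLinearFun D f) →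
      ∃ (ι : Type u) (_ : Finite ι) (φ : (Fin n → R) → ι),
        IsSpecialLinearDecomposition D n (Setoid.ker φ).classes ∧
        ∀ f ∈ F, ∀ x y, φ x = φ y → SignType.sign (f x) = SignType.sign (f y) := by
  induction n with
  | zero =>
    intro F _ _
    refine ⟨PUnit, inferInstance, fun _ => PUnit.unit, ?_, fun f _ x y _ => by
      rw [Subsingleton.elim x y]⟩
    change (Setoid.ker _).classes = {univ}
    ext C
    constructor
    · rintro ⟨y, rfl⟩
      exact eq_univ_of_forall fun _ => rfl
    · rintro rfl
      exact ⟨0, (eq_univ_of_forall fun _ => rfl).symm⟩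
  | succ n ih =>
    intro F hF hlin
    choose! f' h hf' hh hsgn using fun f hf => (hlin f hf).exists_sign_eq
    have hHlin : ∀ k ∈ h '' F, IsLinearFun D k := by
      rintro _ ⟨f, hf, rfl⟩
      exact hh f hf
    -- The base parts control signs of `F`; the differences fix the order of the cutting graphs over
    -- each base cell.
    obtain ⟨ι, _, φ, hs, hφ⟩ := ih (f' '' F ∪ image2 (· - ·) (h '' F) (h '' F))
      ((hF.image _).union (Set.Finite.image2 _ (hF.image _) (hF.image _))) (by
        rintro k (⟨f, hf, rfl⟩ | ⟨k₁, hk₁, k₂, hk₂, rfl⟩)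
        · exact hf' f hf
        · exact (hHlin k₁ hk₁).sub (hHlin k₂ hk₂))
    have := (hF.image h).to_subtype
    refine ⟨_, inferInstance, liftLabel φ (h '' F),
      isSpecialLinearDecomposition_classes_liftLabel (hF.image _) hHlin
        (fun k₁ hk₁ k₂ hk₂ => hφ _ (Or.inr (mem_image2_of_mem hk₁ hk₂))) hs, ?_⟩
    intro f hf x y hxy
    obtain ⟨h₁, h₂⟩ := liftLabel_eq_iff.1 hxy
    exact hsgn f hf x y (hφ _ (Or.inl (mem_image_of_mem _ hf)) _ _ h₁)
      (h₂ _ (mem_image_of_mem _ hf))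

/-! ### Cells are determined by finitely many signs. -/

section Refine

variable {D : Type*} [DivisionRing D] {R : Type*} [AddCommGroup R] [LinearOrder R]
  [IsOrderedAddMonoid R] [Module D R]

theorem IsLinearFunInfty.exists_linear_lt_iff {n : ℕ} {f : (Fin n → R) → Ext R}
    (hf : IsLinearFunInfty D f) : ∃ f₀ : (Fin n → R) → R, IsLinearFun D f₀ ∧
      ∀ x y : Fin (n + 1) → R,
        SignType.sign (last x - f₀ (proj x)) = SignType.sign (last y - f₀ (proj y)) →
        (f (proj x) < toExt (last x) ↔ f (proj y) < toExt (last y)) ∧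
        (toExt (last x) < f (proj x) ↔ toExt (last y) < f (proj y)) := by
  rcases hf with ⟨f₀, hf₀, e⟩ | e | e
  · refine ⟨f₀, hf₀, fun x y hxy => ?_⟩
    have := compare_congr_of_sign_sub_eq hxy
    exact ⟨by simpa [e, toExt] using this.2.1, by simpa [e, toExt] using this.1⟩
  -- Comparison with an infinite bound is constant, so any linear function serves.
  · exact ⟨_, isLinearFun_zero, fun x y _ => by simp [e, toExt]⟩
  · refine ⟨_, isLinearFun_zero, fun x y _ => ?_⟩
    have : ∀ r : R, toExt r < ⊤ := fun r => WithBot.coe_lt_coe.2 (WithTop.coe_lt_top _)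
    simp [e, this]

/-- Membership in a linear cell depends only on the signs of finitely many linear functions. -/
theorem IsLinearCell.exists_finite_sign {n : ℕ} : ∀ {C : Set (Fin n → R)}, IsLinearCell D n C →
    ∃ F : Set ((Fin n → R) → R), F.Finite ∧ (∀ f ∈ F, IsLinearFun D f) ∧
      ∀ x y, (∀ f ∈ F, SignType.sign (f x) = SignType.sign (f y)) → x ∈ C → y ∈ C := by
  induction n with
  | zero =>
    rintro C rfl
    exact ⟨∅, finite_empty, by simp, by simp⟩
  | succ n ih =>
    rintro C ⟨X, hX, hC⟩
    obtain ⟨F, hF, hlin, hmem⟩ := ih hX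
    rcases hC with ⟨f, hf, rfl⟩ | ⟨f, g, hf, hg, -, rfl⟩
    · refine ⟨insert (fun x => last x - f (proj x)) ((fun k x => k (proj x)) '' F),
        (hF.image _).insert _, ?_, ?_⟩
      · rintro k (rfl | ⟨k, hk, rfl⟩)
        · exact hf.last_sub
        · exact (hlin k hk).comp_proj
      · intro x y hxy hx
        exact ⟨hmem _ _ (fun k hk => hxy _ (Or.inr (mem_image_of_mem _ hk))) hx.1,
          (compare_congr_of_sign_sub_eq (hxy _ (Or.inl rfl))).2.2.1 hx.2⟩
    · obtain ⟨f₀, hf₀, hf₁⟩ := hf.exists_linear_lt_iff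
      obtain ⟨g₀, hg₀, hg₁⟩ := hg.exists_linear_lt_iff
      refine ⟨insert (fun x => last x - f₀ (proj x)) (insert (fun x => last x - g₀ (proj x))
        ((fun k x => k (proj x)) '' F)), ((hF.image _).insert _).insert _, ?_, ?_⟩
      · rintro k (rfl | rfl | ⟨k, hk, rfl⟩)
        · exact hf₀.last_sub
        · exact hg₀.last_sub
        · exact (hlin k hk).comp_proj
      · intro x y hxy hx
        exact ⟨hmem _ _ (fun k hk => hxy _ (Or.inr (Or.inr (mem_image_of_mem _ hk)))) hx.1,
          (hf₁ x y (hxy _ (Or.inl rfl))).1.1 hx.2.1,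
          (hg₁ x y (hxy _ (Or.inr (Or.inl rfl)))).2.1 hx.2.2⟩

end Refine

end LinearCells

theorem mainTheorem6 {D : Type*} [DivisionRing D] [LinearOrder D] [IsStrictOrderedRing D]
    {R : Type*} [AddCommGroup R] [LinearOrder R] [IsOrderedAddMonoid R] [Nontrivial R]
    [Module D R] [IsStrictOrderedModule D R] [TopologicalSpace R] [OrderTopology R]
    (n : ℕ) (hn : 0 < n) (𝒟 : Set (Set (Fin n → R)))
    (h𝒟 : LinearCells.IsLinearDecomposition D n 𝒟) :
    ∃ 𝒞 : Set (Set (Fin n → R)),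
      LinearCells.IsSpecialLinearDecomposition D n 𝒞 ∧ LinearCells.Refines 𝒞 𝒟 := by
  have hfin : 𝒟.Finite := by
    cases n with
    | zero => exact absurd hn (lt_irrefl 0)
    | succ n => exact h𝒟.1
  choose! F hF hlin hmem using fun C hC => (h𝒟.isLinearCell C hC).exists_finite_sign
  obtain ⟨ι, _, φ, hs, hφ⟩ := LinearCells.exists_special_sign_const (D := D) n (⋃ C ∈ 𝒟, F C)
    (hfin.biUnion hF) (by
      intro f hf
      simp only [mem_iUnion] at hf
      obtain ⟨C, hC, hf⟩ := hf
      exact hlin C hC f hf)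
  -- A class meeting `E` lies inside `E`, because the signs deciding membership are constant on it.
  refine ⟨_, hs, fun E hE => ⟨{C ∈ (Setoid.ker φ).classes | C ⊆ E}, sep_subset _ _, ?_⟩⟩
  refine Subset.antisymm (fun x hx => ?_) (sUnion_subset fun C hC => hC.2)
  refine ⟨{y | φ y = φ x}, ⟨⟨x, rfl⟩, fun y hy => ?_⟩, rfl⟩
  exact hmem E hE x y (fun f hf => hφ f (mem_biUnion hE hf) x y (Eq.symm hy)) hx
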